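/- An instance of the fair allocation problem consists of $n \ge 1$ agents, a finite set $M$ of $m$ items, and for each agent $i$ an additive valuation $v_i : 2^M \to \mathbb{R}$, i.e. $v_i(S) = \sum_{g \in S} v_i(\{g\})$ for all $S \subseteq M$. The items are chores if $v_i(\{g\}) \le 0$ for all agents $i$ and all items $g$. An allocation is a tuple $A = (A_1, \dots, A_n)$ of pairwise disjoint (possibly empty) sets with union $M$. The maximin share of agent $i$ is $\mu_i = \max_{A} \min_{1 \le j \le n} v_i(A_j)$, where $A$ ranges over all allocations, and an MMS allocation is an allocation $A$ with $v_i(A_i) \ge \mu_i$ for every agent $i$. Theorem. For every integer $c > 0$ there exists an integer $0 \le n_c \le \lfloor 0.7838^c \cdot c! \rfloor$ such that every instance with $n \ge \max(n_c, 1)$ agents and at most $n + c$ items, all of which are chores, has an MMS allocation. -/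

import Mathlib

open scoped Nat

/-- An instance of the fair allocation problem with agents `Fin n` and items `Fin m`:
every agent has an additive valuation function on the sets of items. -/
structure FairInstance (n m : ℕ) where
  /-- the valuation function of each agent, defined on all bundles -/
  v : Fin n → Finset (Fin m) → ℝ
  /-- additivity (the empty sum gives `v i ∅ = 0`) -/
  additive : ∀ i S, v i S = ∑ g ∈ S, v i {g}

/-- `A` is an ordered `n`-partition of the items: the bundles are pairwise disjoint and cover
all items. Bundles may be empty. -/
def IsAllocation {n m : ℕ} (A : Fin n → Finset (Fin m)) : Prop :=
  (∀ i j, i ≠ j → Disjoint (A i) (A j)) ∧ ∀ g, ∃ i, g ∈ A i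

namespace FairInstance

variable {n m : ℕ}

/-- All items are chores: every agent assigns a nonpositive value to every item. -/
def IsChores (I : FairInstance n m) : Prop :=
  ∀ i g, I.v i {g} ≤ 0

/-- The maximin share of agent `i`: the maximum over all allocations of the minimum value of a
bundle. Both the allocations and the bundles form finite sets, nonempty as soon as `0 < n`, so
the supremum and the infimum are then a maximum and a minimum. -/
noncomputable def mms (I : FairInstance n m) (i : Fin n) : ℝ :=
  ⨆ A : {A : Fin n → Finset (Fin m) // IsAllocation A}, ⨅ j : Fin n, I.v i (A.1 j)

/-- `A` is an MMS allocation: an allocation in which every agent receives a bundle that she values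
at least at her maximin share. -/
def IsMMSAllocation (I : FairInstance n m) (A : Fin n → Finset (Fin m)) : Prop :=
  IsAllocation A ∧ ∀ i, I.mms i ≤ I.v i (A i)

end FairInstance

section

open Finset

/-! Turn values into costs and let each agent sort the items by increasing cost; allocating
positions is enough, since agents can then pick real items in turn (`exists_perm_le_sort`). An
exchange argument turns the MMS partition of agent `j` into at most `c` bundles of two or more cheap
positions, followed by singletons, which every agent accepts. If no good allocation exists, Hall's
theorem yields a set `X j` of these bundles such that fewer than `#(X j)` agents accept any of them.
Give `j` a key: some bundle of `X j` with one element removed. Few agents share a key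
(`card_le_sum_of_hall_violators`), and few keys occur, because everybody accepts a pair of positions
up to `c`. Hence `n ≤ agentBound c`, which is below the floor in the theorem for `c ≥ 2` except at
`c = 4`, where a finer choice of keys is needed. -/

/-- The bundles with at least two items of a partition of `#P + c` items, labelled by
`0, …, #P + c - 1`, into `#P` bundles. -/
structure IsNontrivialPartition (c : ℕ) (P : Finset (Finset ℕ)) : Prop where
  disjoint : ∀ B ∈ P, ∀ B' ∈ P, ∀ r, r ∈ B → r ∈ B' → B = B'
  mem_iff : ∀ r, (∃ B ∈ P, r ∈ B) ↔ r < #P + c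
  two_le_card : ∀ B ∈ P, 2 ≤ #B

/-! ### Reduction to nontrivial bundles and Hall's condition -/

theorem exists_isNontrivialPartition {ι : Type*} [DecidableEq ι] {w : ℕ → ℝ} (hw : Monotone w)
    (h0 : ∀ r, 0 ≤ w r) {c : ℕ} (hc : 0 < c) {μ : ℝ} (k : ℕ) (L : Finset ι) (f : ℕ → ι)
    (hk : #L = k) (hf : ∀ r < k + c, f r ∈ L)
    (hμ : ∀ a ∈ L, ∑ r ∈ range (k + c) with f r = a, w r ≤ μ) :
    ∃ P : Finset (Finset ℕ), IsNontrivialPartition c P ∧ #P ≤ k ∧ ∀ B ∈ P, ∑ r ∈ B, w r ≤ μ := by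
  induction k generalizing L f with
  | zero =>
    rw [card_eq_zero] at hk
    simpa [hk] using hf 0 (by omega)
  | succ k ih =>
    by_cases h2 : ∀ a ∈ L, 2 ≤ #{r ∈ range (k + 1 + c) | f r = a}
    · have hinj : Set.InjOn (fun a => {r ∈ range (k + 1 + c) | f r = a}) (L : Set ι) := by
        intro a ha b hb hab
        obtain ⟨r, hr⟩ := card_pos.1 (lt_of_lt_of_le two_pos (h2 a ha))
        have hr' := hr
        simp only at hab
        rw [hab] at hr'
        rw [← (mem_filter.1 hr).2, ← (mem_filter.1 hr').2]
      have hcard : #(L.image fun a => {r ∈ range (k + 1 + c) | f r = a}) = k + 1 := by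
        rw [card_image_of_injOn hinj, hk]
      refine ⟨L.image fun a => {r ∈ range (k + 1 + c) | f r = a}, ⟨?_, ?_, ?_⟩, hcard.le, ?_⟩
      · simp only [mem_image, forall_exists_index, and_imp, forall_apply_eq_imp_iff₂, mem_filter]
        rintro a - b - r - rfl - rfl
        rfl
      · intro r
        rw [hcard]
        simp only [mem_image, exists_exists_and_eq_and, mem_filter, mem_range]
        exact ⟨fun ⟨_, _, h, _⟩ => h, fun h => ⟨f r, hf r h, h, rfl⟩⟩
      · simpa using h2
      · simpa using hμ
    · push Not at h2
      obtain ⟨a, ha, hcard⟩ := h2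
      have hN : k + 1 + c = k + c + 1 := by omega
      rw [hN] at hcard hμ hf
      have hsub : ∀ r < k + c, f r = a → f (k + c) ≠ a := by
        intro r hr hra hka
        have : #{r, k + c} ≤ #{r ∈ range (k + c + 1) | f r = a} := by
          apply card_le_card
          intro x
          simp only [mem_insert, mem_singleton, mem_filter, mem_range]
          rintro (rfl | rfl)
          · exact ⟨by omega, hra⟩
          · exact ⟨by omega, hka⟩
        rw [card_pair (by omega)] at this
        omega
      -- Bundle `a` has at most one item. Exchange that item, if any, with the costliest item `k +
      -- c`, then discard `a` and `k + c`; no other bundle gets more expensive.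
      refine (ih (L.erase a) (fun r => if f r = a then f (k + c) else f r) ?_ ?_ ?_).imp
        fun P hP => ⟨hP.1, by omega, hP.2.2⟩
      · rw [card_erase_of_mem ha, hk]; rfl
      · intro r hr
        simp only [mem_erase]
        split_ifs with h
        · exact ⟨hsub r hr h, hf _ (by omega)⟩
        · exact ⟨h, hf _ (by omega)⟩
      · intro b hb
        obtain ⟨hba, hbL⟩ := mem_erase.1 hb
        have hb' := hμ b hbL
        rw [sum_filter, sum_range_succ] at hb'
        rw [sum_filter]
        by_cases hbk : f (k + c) = b
        · have hle : ∑ r ∈ range (k + c) with f r = a, w r ≤ w (k + c) := by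
            have h1 : #{r ∈ range (k + c) | f r = a} ≤ 1 :=
              (card_le_card (filter_subset_filter _ (range_mono (by omega)))).trans
                (Nat.le_of_lt_succ hcard)
            refine (sum_le_card_nsmul _ _ (w (k + c)) ?_).trans ?_
            · intro r hr
              exact hw (mem_range.1 (mem_filter.1 hr).1).le
            · rw [nsmul_eq_mul]
              exact mul_le_of_le_one_left (h0 _) (by exact_mod_cast h1)
          have hsum : ∀ r ∈ range (k + c),
              (if (if f r = a then f (k + c) else f r) = b then w r else 0)
                = (if f r = b then w r else 0) + if f r = a then w r else 0 := by
            intro r _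
            by_cases h : f r = a
            · simp [h, hbk, Ne.symm hba]
            · simp [h]
          rw [sum_congr rfl hsum, sum_add_distrib, ← sum_filter (fun r => f r = a)]
          rw [if_pos hbk] at hb'
          linarith
        · refine (sum_le_sum fun r _ => ?_).trans
            ((le_add_of_nonneg_right (by simp [hbk])).trans hb')
          by_cases h : f r = a
          · simp [h, hbk, Ne.symm hba]
          · simp [h]

/-- The positions outside `P` are at most as many as the agents left unmatched, so each can go to an
agent of its own. -/
theorem exists_owner_of_injOn {n c : ℕ} (hpos : 0 < n) {w : Fin n → ℕ → ℝ} {μ : Fin n → ℝ}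
    (hμ : ∀ i, 0 ≤ μ i) (h1 : ∀ i, ∀ r < n + c, w i r ≤ μ i) {P : Finset (Finset ℕ)}
    (hP : IsNontrivialPartition c P) (hn : #P ≤ n) {g : Finset ℕ → Fin n}
    (hg : Set.InjOn g P) (hgμ : ∀ B ∈ P, ∑ r ∈ B, w (g B) r ≤ μ (g B)) :
    ∃ f : ℕ → Fin n, ∀ i, ∑ r ∈ range (n + c) with f r = i, w i r ≤ μ i := by
  have hcompl : #(Ico (#P + c) (n + c)) ≤ #(P.image g)ᶜ := by
    rw [card_compl, card_image_of_injOn hg, Nat.card_Ico, Fintype.card_fin]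
    omega
  have : Nonempty (Fin n) := ⟨⟨0, hpos⟩⟩
  obtain ⟨e, he, heinj⟩ : ∃ e : ℕ → Fin n, (∀ r ∈ Ico (#P + c) (n + c), e r ∈ (P.image g)ᶜ) ∧
      Set.InjOn e (Ico (#P + c) (n + c) : Finset ℕ) := by
    obtain ⟨e, h, h'⟩ := (finite_toSet (Ico (#P + c) (n + c))).exists_injOn_of_encard_le
      (t := (((P.image g)ᶜ : Finset (Fin n)) : Set (Fin n))) (by
        simpa only [Set.encard_coe_eq_coe_finsetCard, Nat.cast_le] using hcompl)
    exact ⟨e, fun r hr => h hr, h'⟩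
  choose! b hbP hb using fun r => (hP.mem_iff r).2
  refine ⟨fun r => if r < #P + c then g (b r) else e r, fun i => ?_⟩
  by_cases hi : ∃ B ∈ P, g B = i
  · obtain ⟨B, hB, rfl⟩ := hi
    convert hgμ B hB using 2
    ext r
    simp only [mem_filter, mem_range]
    constructor
    · rintro ⟨hr, h⟩
      split_ifs at h with hr'
      · rw [← hg (hbP r hr') hB h]
        exact hb r hr'
      · have := he r (mem_Ico.2 ⟨by omega, hr⟩)
        rw [h] at this
        simp only [mem_compl, mem_image, not_exists, not_and] at this
        exact absurd rfl (this B hB)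
    · intro hr
      have hr' := (hP.mem_iff r).1 ⟨B, hB, hr⟩
      rw [if_pos hr']
      exact ⟨by omega, by rw [hP.disjoint _ (hbP r hr') _ hB r (hb r hr') hr]⟩
  · have hcard : #{r ∈ range (n + c) | (if r < #P + c then g (b r) else e r) = i} ≤ 1 := by
      refine card_le_one.2 fun r hr r' hr' => ?_
      have key : ∀ r, r ∈ range (n + c) ∧ (if r < #P + c then g (b r) else e r) = i →
          r ∈ Ico (#P + c) (n + c) ∧ e r = i := by
        rintro r ⟨hr, h⟩
        split_ifs at h with hr'
        · exact absurd ⟨_, hbP r hr', h⟩ hi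
        · exact ⟨mem_Ico.2 ⟨by omega, mem_range.1 hr⟩, h⟩
      have h := key r (mem_filter.1 hr)
      have h' := key r' (mem_filter.1 hr')
      exact heinj h.1 h'.1 (h.2.trans h'.2.symm)
    refine (sum_le_card_nsmul _ _ (μ i) fun r hr =>
      h1 i r (mem_range.1 (mem_filter.1 hr).1)).trans ?_
    rw [nsmul_eq_mul]
    exact mul_le_of_le_one_left (hμ i) (by exact_mod_cast hcard)

theorem exists_hall_violator {n c : ℕ} (hpos : 0 < n) {w : Fin n → ℕ → ℝ} {μ : Fin n → ℝ}
    (hμ : ∀ i, 0 ≤ μ i) (h1 : ∀ i, ∀ r < n + c, w i r ≤ μ i) {P : Finset (Finset ℕ)}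
    (hP : IsNontrivialPartition c P) (hn : #P ≤ n)
    (hno : ¬∃ f : ℕ → Fin n, ∀ i, ∑ r ∈ range (n + c) with f r = i, w i r ≤ μ i) :
    ∃ X ⊆ P, #{i | ∃ B ∈ X, ∑ r ∈ B, w i r ≤ μ i} < #X := by
  by_contra! hX
  have hall := (all_card_le_biUnion_card_iff_exists_injective
    (fun B : P => ({i | ∑ r ∈ B.1, w i r ≤ μ i} : Finset (Fin n)))).1 ?_
  · obtain ⟨g, hginj, hg⟩ := hall
    refine hno (exists_owner_of_injOn hpos hμ h1 hP hn
      (g := fun B => if h : B ∈ P then g ⟨B, h⟩ else ⟨0, hpos⟩) ?_ ?_)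
    · intro B hB B' hB' h
      simp only [dif_pos (mem_coe.1 hB), dif_pos (mem_coe.1 hB')] at h
      simpa using hginj h
    · intro B hB
      simpa [hB] using hg ⟨B, hB⟩
  · intro s
    have := hX (s.map (Function.Embedding.subtype _)) (by
      intro B hB
      obtain ⟨B', -, rfl⟩ := mem_map.1 hB
      exact B'.2)
    rw [card_map] at this
    refine this.trans (card_le_card ?_)
    intro i
    simp

/-! ### Counting agents by keys -/

/-- Among the agents with a common key `T`, let `j` have the smallest extra element `x j`. By
monotonicity they all accept `insert (x j) T`, a bundle of `X j`, so there are fewer than `#(X j)`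
of them. -/
theorem card_le_sum_of_hall_violators {n : ℕ} {w : Fin n → ℕ → ℝ} (hw : ∀ i, Monotone (w i))
    {μ : Fin n → ℝ} {X : Fin n → Finset (Finset ℕ)}
    (hX : ∀ j, #{i | ∃ B ∈ X j, ∑ r ∈ B, w i r ≤ μ i} < #(X j))
    (hacc : ∀ j, ∀ B ∈ X j, ∑ r ∈ B, w j r ≤ μ j)
    {K : Finset (Finset ℕ)} {β : Finset ℕ → ℕ}
    (hK : ∀ j, ∃ x, ∃ T ∈ K, x ∉ T ∧ insert x T ∈ X j ∧ #(X j) ≤ β T + 1) :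
    n ≤ ∑ T ∈ K, β T := by
  choose x T hTK hx hmem hβ using hK
  calc n = #(univ : Finset (Fin n)) := by simp
    _ = ∑ S ∈ K, #{j | T j = S} := card_eq_sum_card_fiberwise fun j _ => hTK j
    _ ≤ ∑ S ∈ K, β S := sum_le_sum fun S _ => ?_
  rcases (filter (fun j => T j = S) univ).eq_empty_or_nonempty with h | h
  · simp [h]
  · obtain ⟨j, hj, hmin⟩ := exists_min_image _ x h
    obtain rfl := (mem_filter.1 hj).2
    have hsub : #{i | T i = T j} ≤ #{i | ∃ B ∈ X j, ∑ r ∈ B, w i r ≤ μ i} := by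
      refine card_le_card fun i hi => ?_
      have hiT := (mem_filter.1 hi).2
      refine mem_filter.2 ⟨mem_univ _, _, hmem j, ?_⟩
      have := hacc i _ (hmem i)
      rw [sum_insert (hx i), hiT] at this
      rw [sum_insert (hx j)]
      linarith [hw i (hmin i hi)]
    have := hX j
    have := hβ j
    omega

/-- Pigeonhole: two of the `n + 1` costliest positions `c - 1, …, n + c - 1` share a bundle, and
they dominate `x` and `y`. -/
theorem sum_pair_le_of_lt {n c : ℕ} {w : ℕ → ℝ} (hw : Monotone w)
    (h0 : ∀ r, 0 ≤ w r) {μ : ℝ} (f : ℕ → Fin n)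
    (hf : ∀ a, ∑ r ∈ range (n + c) with f r = a, w r ≤ μ) {x y : ℕ} (hxy : x < y) (hy : y ≤ c) :
    w x + w y ≤ μ := by
  obtain ⟨a, ha, b, hb, hab, hfab⟩ := exists_ne_map_eq_of_card_lt_of_maps_to
    (s := Ico (c - 1) (n + c)) (t := univ) (f := f) (by simp; omega) (fun _ _ => by simp)
  wlog hlt : a < b generalizing a b
  · exact this b hb a ha hab.symm hfab.symm (by omega)
  rw [mem_Ico] at ha hb
  have hsub : ({a, b} : Finset ℕ) ⊆ {r ∈ range (n + c) | f r = f b} := by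
    intro r
    simp only [mem_insert, mem_singleton, mem_filter, mem_range]
    rintro (rfl | rfl)
    · exact ⟨ha.2, hfab⟩
    · exact ⟨hb.2, rfl⟩
  have := (sum_le_sum_of_subset_of_nonneg hsub fun r _ _ => h0 r).trans (hf (f b))
  rw [sum_pair hab] at this
  linarith [hw (show x ≤ a by omega), hw (show y ≤ b by omega)]

/-! ### Sizes and keys of violating sets -/

theorem IsNontrivialPartition.sum_card_add_card_le {c : ℕ} {P X : Finset (Finset ℕ)}
    (hP : IsNontrivialPartition c P) (hX : X ⊆ P) : ∑ B ∈ X, #B + #P ≤ c + 2 * #X := by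
  have h1 : ∑ B ∈ P, #B = #P + c := by
    rw [← card_range (#P + c), ← card_biUnion]
    · congr 1
      ext r
      simpa using hP.mem_iff r
    · intro B hB B' hB' hne
      exact disjoint_left.2 fun r hr hr' => hne (hP.disjoint B hB B' hB' r hr hr')
  have h2 : #(P \ X) * 2 ≤ ∑ B ∈ P \ X, #B :=
    card_nsmul_le_sum _ _ _ fun B hB => hP.two_le_card B (mem_sdiff.1 hB).1
  have h3 := sum_sdiff (f := fun B : Finset ℕ => #B) hX
  have h4 := card_sdiff_add_card_eq_card hX
  omega

theorem IsNontrivialPartition.card_le {c : ℕ} {P : Finset (Finset ℕ)}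
    (hP : IsNontrivialPartition c P) : #P ≤ c := by
  simpa using hP.sum_card_add_card_le (empty_subset P)

theorem IsNontrivialPartition.exists_pair {c : ℕ} {P X : Finset (Finset ℕ)}
    (hP : IsNontrivialPartition c P) (hX : X ⊆ P) (h2 : 2 ≤ #X)
    (hlow : ∀ x y, x < y → y ≤ c → {x, y} ∉ X) (hpair : ∃ B ∈ X, #B = 2) :
    #X ≤ c - 1 ∧ ∃ x, ∃ y ∈ Icc (c + 1) (2 * c - 2), x ≠ y ∧ {x, y} ∈ X := by
  have hform : ∀ B ∈ X, #B = 2 → ∃ x y, x < y ∧ c < y ∧ y < #P + c ∧ B = {x, y} := by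
    intro B hB hcard
    obtain ⟨x, y, hne, rfl⟩ := card_eq_two.1 hcard
    wlog hlt : x < y generalizing x y
    · obtain ⟨x', y', h⟩ := this y x hne.symm (by rwa [pair_comm]) (by rwa [pair_comm]) (by omega)
      exact ⟨x', y', by rwa [pair_comm x y]⟩
    exact ⟨x, y, hlt, by by_contra h; exact hlow x y hlt (by omega) hB,
      (hP.mem_iff y).1 ⟨_, hX hB, by simp⟩, rfl⟩
  -- If `#P < c`, positions stop at `2 * c - 2`. If `#P = c`, all bundles are pairs, and the smaller
  -- of two distinct upper elements avoids `2 * c - 1`.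
  rcases hP.card_le.lt_or_eq with hlt | heq
  · refine ⟨(card_le_card hX).trans (by omega), ?_⟩
    obtain ⟨B, hB, hcard⟩ := hpair
    obtain ⟨x, y, hxy, hy, hy', rfl⟩ := hform B hB hcard
    exact ⟨x, y, mem_Icc.2 ⟨by omega, by omega⟩, hxy.ne, hB⟩
  · have hall : ∀ B ∈ X, #B = 2 := by
      intro B hB
      have := hP.sum_card_add_card_le (singleton_subset_iff.2 (hX hB))
      have := hP.two_le_card B (hX hB)
      simp only [sum_singleton, card_singleton] at *
      omega
    choose! x y hxy hcy hyP hBxy using fun B hB => hform B hB (hall B hB)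
    have hyB : ∀ B ∈ X, y B ∈ B := by
      intro B hB
      have : y B ∈ ({x B, y B} : Finset ℕ) := by simp
      rwa [← hBxy B hB] at this
    have hinj : Set.InjOn y X := by
      intro B hB B' hB' h
      exact hP.disjoint B (hX hB) B' (hX hB') (y B) (hyB B hB) (h ▸ hyB B' hB')
    constructor
    · have := card_le_card_of_injOn (t := Ico (c + 1) (#P + c)) y
        (fun B hB => by simpa using ⟨hcy B hB, hyP B hB⟩) hinj
      rw [Nat.card_Ico] at this
      omega
    · obtain ⟨B, hB, B', hB', hne⟩ := one_lt_card.1 h2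
      have hne' : y B ≠ y B' := fun h => hne (hinj hB hB' h)
      rcases hne'.lt_or_gt with h | h
      · exact ⟨x B, y B, mem_Icc.2 ⟨hcy B hB, by have := hyP B' hB'; omega⟩, (hxy B hB).ne,
          hBxy B hB ▸ hB⟩
      · exact ⟨x B', y B', mem_Icc.2 ⟨hcy B' hB', by have := hyP B hB; omega⟩, (hxy B' hB').ne,
          hBxy B' hB' ▸ hB'⟩

theorem IsNontrivialPartition.card_mul_le {c t : ℕ} {P X : Finset (Finset ℕ)}
    (hP : IsNontrivialPartition c P) (hX : X ⊆ P) (h : ∀ B ∈ X, t + 1 ≤ #B) :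
    #X * t + #P ≤ c + #X := by
  have h1 := hP.sum_card_add_card_le hX
  have h2 : #X * (t + 1) ≤ ∑ B ∈ X, #B := card_nsmul_le_sum _ _ _ h
  rw [mul_add] at h2
  omega

theorem IsNontrivialPartition.exists_of_forall_three_le {c : ℕ} {P X : Finset (Finset ℕ)}
    (hP : IsNontrivialPartition c P) (hX : X ⊆ P) (h2 : 2 ≤ #X) (h3 : ∀ B ∈ X, 3 ≤ #B) :
    ∃ t ∈ Icc 2 (c / 2), ∃ T ∈ powersetCard t (Icc 1 (2 * c + 1 - 2 * t)),
      ∃ x, x ∉ T ∧ insert x T ∈ X ∧ #X ≤ c / t := by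
  obtain ⟨B, hB, hmin⟩ := exists_min_image X (fun B => #B) (card_pos.1 (by omega))
  have hB3 := h3 B hB
  have hne : B.Nonempty := card_pos.1 (by omega)
  obtain ⟨t, ht⟩ : ∃ t, #B = t + 1 := ⟨#B - 1, by omega⟩
  have h4 := hP.card_mul_le (t := t) hX fun B' hB' => ht ▸ hmin B' hB'
  have h5 := card_le_card hX
  -- This bounds every position of `B` by `2 * c + 1 - 2 * t`; dropping the minimum of `B` also
  -- excludes position `0`.
  have h6 : 2 * t + #P ≤ c + 2 := by
    obtain ⟨d, hd⟩ := Nat.exists_eq_add_of_le h2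
    obtain ⟨s, rfl⟩ := Nat.exists_eq_add_of_le (show 2 ≤ t by omega)
    rw [hd] at h4
    nlinarith [Nat.zero_le (d * s)]
  refine ⟨t, mem_Icc.2 ⟨by omega, by omega⟩, B.erase (B.min' hne), mem_powersetCard.2 ⟨?_, ?_⟩,
    B.min' hne, notMem_erase _ _, ?_, ?_⟩
  · intro r hr
    have h7 := min'_lt_of_mem_erase_min' _ hne hr
    have h8 := (hP.mem_iff r).1 ⟨B, hX hB, mem_of_mem_erase hr⟩
    exact mem_Icc.2 ⟨by omega, by omega⟩
  · rw [card_erase_of_mem (min'_mem _ _), ht]; rfl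
  · rwa [insert_erase (min'_mem _ _)]
  · rw [Nat.le_div_iff_mul_le (by omega)]
    omega

theorem IsNontrivialPartition.exists_of_forall_three_le_of_four {P X : Finset (Finset ℕ)}
    (hP : IsNontrivialPartition 4 P) (hX : X ⊆ P) (h2 : 2 ≤ #X) (h3 : ∀ B ∈ X, 3 ≤ #B) :
    #X ≤ 2 ∧ ∃ T ∈ {T ∈ powersetCard 2 (Icc 1 5) | 5 ∈ T}, ∃ x, x ∉ T ∧ insert x T ∈ X := by
  have h4 := hP.card_mul_le (t := 2) hX h3
  have h5 := card_le_card hX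
  -- Here `P` consists of two triples covering `0, …, 5`; choosing the one that contains `5` saves
  -- keys.
  obtain rfl : X = P := eq_of_subset_of_card_le hX (by omega)
  obtain ⟨B, hB, h5B⟩ := (hP.mem_iff 5).2 (by omega)
  have hcard : #B = 3 := by
    have h6 := hP.sum_card_add_card_le subset_rfl
    have h7 : #(X.erase B) * 3 ≤ ∑ B ∈ X.erase B, #B :=
      card_nsmul_le_sum _ _ _ fun B' hB' => h3 B' (mem_of_mem_erase hB')
    rw [← add_sum_erase _ _ hB] at h6
    rw [card_erase_of_mem hB] at h7
    have := h3 B hB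
    omega
  have hne : B.Nonempty := ⟨5, h5B⟩
  have hcard' : #(B.erase (B.min' hne)) = 2 := by
    rw [card_erase_of_mem (min'_mem _ _), hcard]
  have hsub : ∀ r ∈ B.erase (B.min' hne), B.min' hne < r ∧ r < 6 := by
    intro r hr
    have := (hP.mem_iff r).1 ⟨B, hB, mem_of_mem_erase hr⟩
    exact ⟨min'_lt_of_mem_erase_min' _ hne hr, by omega⟩
  refine ⟨by omega, B.erase (B.min' hne), mem_filter.2 ⟨mem_powersetCard.2 ⟨?_, hcard'⟩, ?_⟩,
    B.min' hne, notMem_erase _ _, ?_⟩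
  · intro r hr
    have := hsub r hr
    exact mem_Icc.2 ⟨by omega, by omega⟩
  · refine mem_erase.2 ⟨fun h => ?_, h5B⟩
    obtain ⟨r, hr⟩ := card_pos.1 (show 0 < #(B.erase (B.min' hne)) by omega)
    have := hsub r hr
    omega
  · rwa [insert_erase (min'_mem _ _)]

/-! ### Bounding the number of agents -/

/-- A bound on the number of agents in an instance with `c` more items than agents that has no
allocation meeting the thresholds. -/
def agentBound (c : ℕ) : ℕ :=
  (c - 2) * (c - 2) + ∑ t ∈ Icc 2 (c / 2), (2 * c + 1 - 2 * t).choose t * (c / t - 1)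

theorem exists_violating_bundles {n c : ℕ} (hc : 0 < c) (hpos : 0 < n) {w : Fin n → ℕ → ℝ}
    (hw : ∀ i, Monotone (w i)) (h0 : ∀ i r, 0 ≤ w i r) {μ : Fin n → ℝ}
    (hf : ∀ i, ∃ f : ℕ → Fin n, ∀ a, ∑ r ∈ range (n + c) with f r = a, w i r ≤ μ i)
    (hno : ¬∃ f : ℕ → Fin n, ∀ i, ∑ r ∈ range (n + c) with f r = i, w i r ≤ μ i) :
    ∃ P X : Fin n → Finset (Finset ℕ), (∀ j, IsNontrivialPartition c (P j)) ∧
      (∀ j, X j ⊆ P j) ∧ (∀ j, #{i | ∃ B ∈ X j, ∑ r ∈ B, w i r ≤ μ i} < #(X j)) ∧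
      (∀ j, ∀ B ∈ X j, ∑ r ∈ B, w j r ≤ μ j) ∧ (∀ j, 2 ≤ #(X j)) ∧
      ∀ j, ∀ x y, x < y → y ≤ c → {x, y} ∉ X j := by
  choose f hf using hf
  have h1 : ∀ i, ∀ r < n + c, w i r ≤ μ i := by
    intro i r hr
    refine le_trans ?_ (hf i (f i r))
    exact single_le_sum (f := w i) (fun r _ => h0 i r) (mem_filter.2 ⟨mem_range.2 hr, rfl⟩)
  have hμ : ∀ i, 0 ≤ μ i := fun i => (h0 i 0).trans (h1 i 0 (by omega))
  choose P hP hPn hPμ using fun i => exists_isNontrivialPartition (hw i) (h0 i) hc n univ (f i)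
    (by simp) (by simp) (fun a _ => hf i a)
  choose X hXP hX using fun j => exists_hall_violator hpos hμ h1 (hP j) (hPn j) hno
  have hacc : ∀ j, ∀ B ∈ X j, ∑ r ∈ B, w j r ≤ μ j := fun j B hB => hPμ j B (hXP j hB)
  refine ⟨P, X, hP, hXP, hX, hacc, fun j => ?_, fun j x y hxy hy hmem => ?_⟩
  -- Agent `j` accepts her own bundles, so at least one agent is counted.
  · obtain ⟨B, hB⟩ := card_pos.1 ((Nat.zero_le _).trans_lt (hX j))
    have : 0 < #{i | ∃ B ∈ X j, ∑ r ∈ B, w i r ≤ μ i} :=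
      card_pos.2 ⟨j, mem_filter.2 ⟨mem_univ _, B, hB, hacc j B hB⟩⟩
    have := hX j
    omega
  -- All `n` agents would accept this pair, but fewer than `#(X j) ≤ #(P j) ≤ n` may.
  · have h2 : (univ : Finset (Fin n)) ⊆ ({i | ∃ B ∈ X j, ∑ r ∈ B, w i r ≤ μ i} : Finset _) := by
      intro i _
      refine mem_filter.2 ⟨mem_univ _, _, hmem, ?_⟩
      rw [sum_pair hxy.ne]
      exact sum_pair_le_of_lt (hw i) (h0 i) (f i) (hf i) hxy hy
    have h3 := card_le_card h2
    have h4 := hX j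
    have h5 := card_le_card (hXP j)
    have h6 := hPn j
    rw [card_univ, Fintype.card_fin] at h3
    omega

theorem exists_owner_of_agentBound_lt {n c : ℕ} (hc : 0 < c) (hpos : 0 < n)
    (hn : agentBound c < n) {w : Fin n → ℕ → ℝ}
    (hw : ∀ i, Monotone (w i)) (h0 : ∀ i r, 0 ≤ w i r) {μ : Fin n → ℝ}
    (hf : ∀ i, ∃ f : ℕ → Fin n, ∀ a, ∑ r ∈ range (n + c) with f r = a, w i r ≤ μ i) :
    ∃ f : ℕ → Fin n, ∀ i, ∑ r ∈ range (n + c) with f r = i, w i r ≤ μ i := by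
  by_contra hno
  obtain ⟨P, X, hP, hXP, hX, hacc, h2, hlow⟩ := exists_violating_bundles hc hpos hw h0 hf hno
  refine hn.not_ge ?_
  set K₁ : Finset (Finset ℕ) := (Icc (c + 1) (2 * c - 2)).image fun y => {y} with hK₁
  set K₂ : Finset (Finset ℕ) :=
    (Icc 2 (c / 2)).biUnion fun t => powersetCard t (Icc 1 (2 * c + 1 - 2 * t)) with hK₂
  -- The weight of a key is one less than the bound on `#(X j)`: `c - 1` when a pair occurs, `c / t`
  -- otherwise.
  set β : Finset ℕ → ℕ := fun T => if #T = 1 then c - 2 else c / #T - 1 with hβ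
  have hdisj : Disjoint K₁ K₂ := by
    refine disjoint_left.2 fun T hT hT' => ?_
    obtain ⟨y, -, rfl⟩ := mem_image.1 hT
    obtain ⟨t, ht, hT'⟩ := mem_biUnion.1 hT'
    have := (mem_powersetCard.1 hT').2
    rw [card_singleton] at this
    have := (mem_Icc.1 ht).1
    omega
  have hsum : ∑ T ∈ K₁ ∪ K₂, β T = agentBound c := by
    rw [sum_union hdisj, agentBound, hK₁, sum_image (by simp), hK₂, sum_biUnion]
    · congr 1
      · simp only [hβ, card_singleton, if_true, sum_const, Nat.card_Icc, smul_eq_mul]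
        congr 1
        omega
      · refine sum_congr rfl fun t ht => ?_
        have ht2 := (mem_Icc.1 ht).1
        rw [sum_const_nat (m := c / t - 1), card_powersetCard, Nat.card_Icc, Nat.add_sub_cancel]
        intro T hT
        simp only [hβ, (mem_powersetCard.1 hT).2]
        exact if_neg (by omega)
    · intro t _ t' _ hne
      refine disjoint_left.2 fun T hT hT' => hne ?_
      rw [← (mem_powersetCard.1 hT).2, ← (mem_powersetCard.1 hT').2]
  rw [← hsum]
  refine card_le_sum_of_hall_violators hw hX hacc fun j => ?_
  by_cases hpair : ∃ B ∈ X j, #B = 2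
  · obtain ⟨hle, x, y, hy, hxy, hmem⟩ := (hP j).exists_pair (hXP j) (h2 j) (hlow j) hpair
    refine ⟨x, {y}, mem_union_left _ (mem_image_of_mem _ hy), by simpa using hxy, hmem, ?_⟩
    simp only [hβ, card_singleton, if_true]
    omega
  · obtain ⟨t, ht, T, hT, x, hx, hmem, hle⟩ :=
      (hP j).exists_of_forall_three_le (hXP j) (h2 j) fun B hB =>
        lt_of_le_of_ne ((hP j).two_le_card B (hXP j hB)) fun h => hpair ⟨B, hB, h.symm⟩
    refine ⟨x, T, mem_union_right _ (mem_biUnion.2 ⟨t, ht, hT⟩), hx, hmem, ?_⟩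
    have ht2 := (mem_Icc.1 ht).1
    have := h2 j
    simp only [hβ, (mem_powersetCard.1 hT).2]
    rw [if_neg (by omega)]
    omega

theorem exists_owner_of_eight_lt {n : ℕ} (hn : 8 < n) {w : Fin n → ℕ → ℝ}
    (hw : ∀ i, Monotone (w i)) (h0 : ∀ i r, 0 ≤ w i r) {μ : Fin n → ℝ}
    (hf : ∀ i, ∃ f : ℕ → Fin n, ∀ a, ∑ r ∈ range (n + 4) with f r = a, w i r ≤ μ i) :
    ∃ f : ℕ → Fin n, ∀ i, ∑ r ∈ range (n + 4) with f r = i, w i r ≤ μ i := by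
  by_contra hno
  obtain ⟨P, X, hP, hXP, hX, hacc, h2, hlow⟩ :=
    exists_violating_bundles four_pos (by omega) hw h0 hf hno
  refine hn.not_ge ?_
  have hsum : ∑ T ∈ ({{5}, {6}} : Finset (Finset ℕ)) ∪ {T ∈ powersetCard 2 (Icc 1 5) | 5 ∈ T},
      (if #T = 1 then 2 else 1) = 8 := by decide
  rw [← hsum]
  refine card_le_sum_of_hall_violators hw hX hacc fun j => ?_
  by_cases hpair : ∃ B ∈ X j, #B = 2
  · obtain ⟨hle, x, y, hy, hxy, hmem⟩ := (hP j).exists_pair (hXP j) (h2 j) (hlow j) hpair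
    refine ⟨x, {y}, mem_union_left _ ?_, by simpa using hxy, hmem, ?_⟩
    · rw [mem_Icc] at hy
      rw [mem_insert, mem_singleton, singleton_inj, singleton_inj]
      omega
    · simpa using hle
  · obtain ⟨hle, T, hT, x, hx, hmem⟩ :=
      (hP j).exists_of_forall_three_le_of_four (hXP j) (h2 j) fun B hB =>
        lt_of_le_of_ne ((hP j).two_le_card B (hXP j hB)) fun h => hpair ⟨B, hB, h.symm⟩
    refine ⟨x, T, mem_union_right _ hT, hx, hmem, ?_⟩
    rw [(mem_powersetCard.1 (mem_filter.1 hT).1).2]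
    exact hle

/-! ### Numerical estimates -/

theorem agentBound_le (c : ℕ) (hc : 8 ≤ c) : (agentBound c + 1) * 16 ≤ c * c * 4 ^ c := by
  have hsum : ∑ t ∈ Icc 2 (c / 2), (2 * c + 1 - 2 * t).choose t * (c / t - 1)
      ≤ (c / 2) * (2 ^ (2 * c - 3) * (c / 2)) := by
    refine (sum_le_card_nsmul _ _ (2 ^ (2 * c - 3) * (c / 2)) fun t ht => ?_).trans ?_
    · have ht2 := (mem_Icc.1 ht).1
      refine Nat.mul_le_mul ((Nat.choose_le_two_pow _ _).trans
        (Nat.pow_le_pow_right two_pos (by omega))) ((Nat.sub_le _ _).trans ?_)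
      exact Nat.div_le_div_left ht2 two_pos
    · rw [smul_eq_mul, Nat.card_Icc]
      exact Nat.mul_le_mul_right _ (by omega)
  have hpow : 4 ^ c = 8 * 2 ^ (2 * c - 3) := by
    rw [show 4 = 2 ^ 2 by rfl, ← pow_mul, show 8 = 2 ^ 3 by rfl, ← pow_add]
    congr 1
    omega
  have hbig : 16 ≤ 2 ^ (2 * c - 3) :=
    (show 16 = 2 ^ 4 by rfl).le.trans (Nat.pow_le_pow_right two_pos (by omega))
  rw [agentBound, hpow]
  obtain ⟨d, rfl⟩ := Nat.exists_eq_add_of_le hc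
  generalize 2 ^ (2 * (8 + d) - 3) = z at *
  have h1 : (8 + d) / 2 * (z * ((8 + d) / 2)) * 4 ≤ (8 + d) * (8 + d) * z := by
    have : (8 + d) / 2 * 2 ≤ 8 + d := Nat.div_mul_le_self _ _
    calc (8 + d) / 2 * (z * ((8 + d) / 2)) * 4 = ((8 + d) / 2 * 2) * ((8 + d) / 2 * 2) * z := by ring
      _ ≤ _ := Nat.mul_le_mul_right _ (Nat.mul_le_mul this this)
  have h2 : 8 + d - 2 = d + 6 := by omega
  rw [h2]
  have h3 : ((8 + d) * (8 + d)) * 16 ≤ ((8 + d) * (8 + d)) * z := Nat.mul_le_mul_left _ hbig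
  nlinarith

/-- The factorial wins; this crude comparison still fails at `c = 14`, so smaller `c` are evaluated
directly. -/
theorem sq_mul_four_pow_le (c : ℕ) (hc : 15 ≤ c) :
    ((c * c * 4 ^ c : ℕ) : ℝ) ≤ 16 * ((0.7838 : ℝ) ^ c * (c ! : ℝ)) := by
  induction c, hc using Nat.le_induction with
  | base => norm_num [Nat.factorial]
  | succ c hc ih =>
    have hc' : (15 : ℝ) ≤ c := by exact_mod_cast hc
    have hz : (0 : ℝ) < 4 ^ c := by positivity
    rw [pow_succ, Nat.factorial_succ]
    push_cast at ih ⊢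
    calc ((c : ℝ) + 1) * (c + 1) * 4 ^ (c + 1)
        = (4 * (c + 1) * (c + 1)) * 4 ^ c := by ring
      _ ≤ (0.7838 * (c + 1) * (c * c)) * 4 ^ c := by
          refine mul_le_mul_of_nonneg_right ?_ hz.le
          nlinarith [mul_nonneg (by linarith : (0 : ℝ) ≤ c - 15) (by linarith : (0 : ℝ) ≤ c)]
      _ = 0.7838 * (c + 1) * (c * c * 4 ^ c) := by ring
      _ ≤ 0.7838 * (c + 1) * (16 * (0.7838 ^ c * (c ! : ℝ))) :=
          mul_le_mul_of_nonneg_left ih (by positivity)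
      _ = _ := by ring

theorem agentBound_lt_floor (c : ℕ) (hc : 2 ≤ c) (h4 : c ≠ 4) :
    agentBound c < ⌊(0.7838 : ℝ) ^ c * (c ! : ℝ)⌋₊ := by
  rw [← Nat.succ_le_iff, Nat.le_floor_iff (by positivity)]
  rcases lt_or_ge c 15 with h | h
  · interval_cases c <;> first
      | exact absurd rfl h4
      | norm_num [agentBound, sum_Icc_succ_top, Nat.choose, Nat.factorial]
  · have h1 : (((agentBound c + 1) * 16 : ℕ) : ℝ) ≤ _ :=
      (Nat.cast_le.2 (agentBound_le c (by omega))).trans (sq_mul_four_pow_le c h)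
    push_cast at h1 ⊢
    linarith

theorem eight_lt_floor : 8 < ⌊(0.7838 : ℝ) ^ 4 * (4 ! : ℝ)⌋₊ := by
  rw [← Nat.succ_le_iff, Nat.le_floor_iff (by positivity)]
  norm_num [Nat.factorial]

/-! ### From sorted positions back to items -/

/-- Agents who own positions of their own sorted lists of items, and in turn pick the cheapest
item that is left, receive items that are no more expensive than their positions. -/
theorem exists_perm_le_sort {n m : ℕ} (u : Fin n → Fin m → ℝ) (o : Fin m → Fin n) :
    ∃ e : Equiv.Perm (Fin m), ∀ t, u (o t) (e t) ≤ u (o t) (Tuple.sort (u (o t)) t) := by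
  obtain ⟨p, hp, hp'⟩ := (all_card_le_biUnion_card_iff_exists_injective
    (fun t => ({g | u (o t) g ≤ u (o t) (Tuple.sort (u (o t)) t)} : Finset (Fin m)))).1 (by
      intro s
      rcases s.eq_empty_or_nonempty with rfl | hs
      · simp
      -- Hall's condition needs only the owner of the last position of `s`: she accepts her cheapest
      -- items up to that position.
      · have h1 : #s ≤ #(Iic (s.max' hs)) :=
          card_le_card fun t ht => mem_Iic.2 (le_max' _ _ ht)
        refine (h1.trans (card_map (Tuple.sort (u (o (s.max' hs)))).toEmbedding).ge).trans
          (card_le_card fun g hg => ?_)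
        obtain ⟨t, ht, rfl⟩ := mem_map.1 hg
        exact mem_biUnion.2 ⟨_, max'_mem s hs, mem_filter.2 ⟨mem_univ _,
          Tuple.monotone_sort (u (o (s.max' hs))) (mem_Iic.1 ht)⟩⟩)
  exact ⟨Equiv.ofBijective p (Finite.injective_iff_bijective.1 hp),
    fun t => (mem_filter.1 (hp' t)).2⟩

/-- The costs `u` in increasing order, preceded by `d` zeros. -/
noncomputable def sortedCost {m : ℕ} (d : ℕ) (u : Fin m → ℝ) (r : ℕ) : ℝ :=
  if r < d then 0 else if h : r - d < m then u (Tuple.sort u ⟨r - d, h⟩) else ∑ g, u g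

theorem sortedCost_of_lt {m d r : ℕ} (u : Fin m → ℝ) (h : r < d) : sortedCost d u r = 0 :=
  if_pos h

theorem sortedCost_add {m : ℕ} (d : ℕ) (u : Fin m → ℝ) (t : Fin m) :
    sortedCost d u (d + t) = u (Tuple.sort u t) := by
  simp [sortedCost]

theorem sortedCost_nonneg {m : ℕ} (d : ℕ) {u : Fin m → ℝ} (hu : ∀ g, 0 ≤ u g) (r : ℕ) :
    0 ≤ sortedCost d u r := by
  unfold sortedCost
  split_ifs
  exacts [le_rfl, hu _, sum_nonneg fun g _ => hu g]

theorem monotone_sortedCost {m : ℕ} (d : ℕ) {u : Fin m → ℝ} (hu : ∀ g, 0 ≤ u g) :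
    Monotone (sortedCost d u) := by
  intro r r' hr
  by_cases h : r < d
  · rw [sortedCost_of_lt u h]
    exact sortedCost_nonneg d hu r'
  · unfold sortedCost
    rw [if_neg h, if_neg (by omega)]
    split_ifs with h1 h2
    · exact Tuple.monotone_sort u (Fin.mk_le_mk.2 (by omega))
    -- The default value past the last item is the total cost, which keeps the sequence monotone.
    · exact single_le_sum (fun g _ => hu g) (mem_univ _)
    · omega
    · exact le_rfl

theorem sum_filter_sortedCost {m : ℕ} (d : ℕ) (u : Fin m → ℝ) (p : ℕ → Prop) [DecidablePred p] :
    ∑ r ∈ range (d + m) with p r, sortedCost d u r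
      = ∑ t ∈ univ.filter (fun t : Fin m => p (d + t)), u (Tuple.sort u t) := by
  rw [sum_filter, sum_range_add, sum_filter, sum_eq_zero, zero_add, sum_range]
  · simp only [sortedCost_add]
  · intro r hr
    rw [sortedCost_of_lt u (mem_range.1 hr), ite_self]

namespace FairInstance

variable {n m : ℕ}

theorem exists_isAllocation_mms_le (I : FairInstance n m) (hn : 0 < n) (i : Fin n) :
    ∃ A : Fin n → Finset (Fin m), IsAllocation A ∧ ∀ j, I.mms i ≤ I.v i (A j) := by
  have : Nonempty {A : Fin n → Finset (Fin m) // IsAllocation A} :=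
    ⟨fun j => if j = ⟨0, hn⟩ then univ else ∅, by
      intro j k hjk
      by_cases hj : j = ⟨0, hn⟩
      · simp [show k ≠ ⟨0, hn⟩ from fun h => hjk (hj.trans h.symm)]
      · simp [hj], fun g => ⟨⟨0, hn⟩, by simp⟩⟩
  obtain ⟨A, hA⟩ := exists_eq_ciSup_of_finite
    (f := fun A : {A : Fin n → Finset (Fin m) // IsAllocation A} => ⨅ j : Fin n, I.v i (A.1 j))
  refine ⟨A.1, A.2, fun j => ?_⟩
  rw [mms, ← hA]
  exact ciInf_le (Set.finite_range _).bddBelow j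

theorem exists_isMMSAllocation (I : FairInstance n m) (hI : I.IsChores) (hn : 0 < n) (d : ℕ)
    (h : ∀ (w : Fin n → ℕ → ℝ) (μ : Fin n → ℝ), (∀ i, Monotone (w i)) → (∀ i r, 0 ≤ w i r) →
      (∀ i, ∃ f : ℕ → Fin n, ∀ a, ∑ r ∈ range (d + m) with f r = a, w i r ≤ μ i) →
      ∃ f : ℕ → Fin n, ∀ i, ∑ r ∈ range (d + m) with f r = i, w i r ≤ μ i) :
    ∃ A : Fin n → Finset (Fin m), I.IsMMSAllocation A := by
  set u : Fin n → Fin m → ℝ := fun i g => -I.v i {g} with hu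
  have hu0 : ∀ i g, 0 ≤ u i g := fun i g => neg_nonneg.2 (hI i g)
  have hv : ∀ i S, I.v i S = -∑ g ∈ S, u i g := by
    intro i S
    rw [I.additive, hu, sum_neg_distrib, neg_neg]
  obtain ⟨f, hf⟩ := h (fun i => sortedCost d (u i)) (fun i => -I.mms i)
    (fun i => monotone_sortedCost d (hu0 i)) (fun i => sortedCost_nonneg d (hu0 i)) (by
      intro i
      obtain ⟨A, hA, hAi⟩ := I.exists_isAllocation_mms_le hn i
      choose b hb using hA.2
      have hbA : ∀ g a, b g = a ↔ g ∈ A a := fun g a =>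
        ⟨fun h => h ▸ hb g, fun h => by
          by_contra hne
          exact disjoint_left.1 (hA.1 _ _ hne) (hb g) h⟩
      refine ⟨fun r => if hr : r - d < m then b (Tuple.sort (u i) ⟨r - d, hr⟩) else ⟨0, hn⟩,
        fun a => ?_⟩
      rw [sum_filter_sortedCost]
      refine le_trans (le_of_eq ?_) (neg_le_neg (hAi a))
      rw [hv, neg_neg]
      exact sum_equiv (Tuple.sort (u i)) (by simp [hbA]) (fun _ _ => rfl))
  obtain ⟨e, he⟩ := exists_perm_le_sort u fun t => f (d + (t : ℕ))
  refine ⟨fun i => ({t | f (d + (t : ℕ)) = i} : Finset (Fin m)).map e.toEmbedding,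
    ⟨fun i j hij => ?_, fun g => ⟨f (d + (e.symm g : ℕ)), by simp⟩⟩, fun i => ?_⟩
  · refine disjoint_left.2 fun g hg hg' => hij ?_
    simp only [mem_map_equiv, mem_filter, mem_univ, true_and] at hg hg'
    exact hg.symm.trans hg'
  · have hfi := hf i
    rw [sum_filter_sortedCost] at hfi
    rw [hv, sum_map]
    refine le_neg.1 (le_trans (sum_le_sum fun t ht => ?_) hfi)
    have := he t
    rwa [(mem_filter.1 ht).2] at this

end FairInstance

end

theorem theorem4 (c : ℕ) (hc : 0 < c) :
    ∃ n_c : ℕ, n_c ≤ ⌊(0.7838 : ℝ) ^ c * (c ! : ℝ)⌋₊ ∧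
      ∀ n m : ℕ, 0 < n → n_c ≤ n → m ≤ n + c →
        ∀ I : FairInstance n m, I.IsChores →
          ∃ A : Fin n → Finset (Fin m), I.IsMMSAllocation A := by
  refine ⟨_, le_rfl, fun n m hn hcn hm I hI => ?_⟩
  -- Padding with zero-cost positions brings their number to exactly `n + c`.
  refine I.exists_isMMSAllocation hI hn (n + c - m) fun w μ hw h0 hf => ?_
  rw [Nat.sub_add_cancel hm] at hf ⊢
  by_cases h4 : c = 4
  · subst h4
    exact exists_owner_of_eight_lt (eight_lt_floor.trans_le hcn) hw h0 hf
  · refine exists_owner_of_agentBound_lt hc hn ?_ hw h0 hf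
    -- For `c = 1` both the floor and `agentBound` are `0`, so `0 < n` supplies the strict
    -- inequality.
    rcases (show 1 ≤ c from hc).eq_or_lt with rfl | hc2
    · simpa [agentBound] using hn
    · exact (agentBound_lt_floor c hc2 h4).trans_le hcn
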